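/- Let $\Gamma$ be a finite alphabet, let $L \subseteq \Gamma^\omega$ be an $\omega$-regular language (that is, a language of infinite words recognized by a finite nondeterministic Büchi automaton), and let $\alpha \in \Gamma^\omega$ be a fixed infinite word. For $n \ge 0$ let $\alpha[n:]$ denote the suffix of $\alpha$ obtained by deleting its first $n$ letters. There are a regular language $L' \subseteq \Gamma^*$ of finite words and an integer $N \ge 0$ such that, for all $n \ge N$, $\alpha[n:] \in L$ if and only if $\alpha[n:]$ has a finite (possibly empty) prefix in $L'$. Furthermore, if $L$ can be described by a first-order sentence over the signature $\{<\} \cup \{P_a : a \in \Gamma\}$ (with equality), where a word is seen as the structure whose domain is its set of positions, ordered by the usual order $<$, and $P_a$ is the set of positions carrying the letter $a$, then $L'$ can be chosen to be, in addition, described by a first-order sentence over the same signature (interpreted over finite words). -/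

import Mathlib

universe u v

/-- The set of infinite words accepted by a nondeterministic automaton under the Büchi condition:
some run starts in a start state, follows the transitions, and visits accepting states
infinitely often. -/
def NFA.omegaAccepts {Γ : Type u} {σ : Type v} (M : NFA Γ σ) : Set (Stream' Γ) :=
  {x | ∃ ρ : ℕ → σ, ρ 0 ∈ M.start ∧ (∀ i, ρ (i + 1) ∈ M.step (ρ i) (x.get i)) ∧
    ∃ᶠ i in Filter.atTop, ρ i ∈ M.accept}

/-- A set of infinite words is ω-regular if it is accepted by a finite Büchi automaton. -/
def IsOmegaRegular {Γ : Type u} (L : Set (Stream' Γ)) : Prop :=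
  ∃ (σ : Type) (_ : Fintype σ) (M : NFA Γ σ), M.omegaAccepts = L

/-- The relation symbols of the signature of words over the alphabet `Γ`: the binary
symbol `<` and, for each letter, a unary symbol. -/
inductive WordRel (Γ : Type u) : ℕ → Type u
  | lt : WordRel Γ 2
  | letter (a : Γ) : WordRel Γ 1

/-- The relational first-order signature of words (equality is part of the logic). -/
def wordLanguage (Γ : Type u) : FirstOrder.Language.{0, u} :=
  ⟨fun _ => Empty, WordRel Γ⟩

/-- The word structure on an ordered set of positions `P` labelled by `f`:
`<` is the order of the positions, and the symbol of the letter `a` holds at the positions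
labelled `a`. -/
@[reducible]
def wordStructure {Γ : Type u} {P : Type v} [LT P] (f : P → Γ) : (wordLanguage Γ).Structure P where
  funMap := fun g _ => Empty.elim g
  RelMap := fun r =>
    match r with
    | WordRel.lt => fun p => p 0 < p 1
    | WordRel.letter a => fun p => f (p 0) = a

/-- The infinite word `x`, seen as a structure on `ℕ`, satisfies the sentence `φ`. -/
def OmegaWordSatisfies {Γ : Type u} (x : Stream' Γ) (φ : (wordLanguage Γ).Sentence) : Prop :=
  @FirstOrder.Language.Sentence.Realize (wordLanguage Γ) ℕ (wordStructure x.get) φ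

/-- The finite word `w`, seen as a structure on `{0, …, |w| - 1}`, satisfies the sentence `φ`. -/
def FiniteWordSatisfies {Γ : Type u} (w : List Γ) (φ : (wordLanguage Γ).Sentence) : Prop :=
  @FirstOrder.Language.Sentence.Realize (wordLanguage Γ) (Fin w.length) (wordStructure w.get) φ

/-- A set of infinite words is described by a first-order sentence. -/
def IsOmegaFODefinable {Γ : Type u} (L : Set (Stream' Γ)) : Prop :=
  ∃ φ : (wordLanguage Γ).Sentence, ∀ x : Stream' Γ, x ∈ L ↔ OmegaWordSatisfies x φ

/-- A language of finite words is described by a first-order sentence. -/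
def IsFODefinable {Γ : Type u} (L : Language Γ) : Prop :=
  ∃ φ : (wordLanguage Γ).Sentence, ∀ w : List Γ, w ∈ L ↔ FiniteWordSatisfies w φ

/-! Let `φ` map finite words to a finite monoid such that membership in `L` depends only on the
values of the blocks of a factorization. Ramsey gives cuts `i 0 < i 1 < ...` of `α` such that every
factor between two cuts has the same value `e`, an idempotent. `L'` consists of the words whose
value `s` satisfies `s * e = s` and is the value of some `α[m, i k)` with `α[m:] ∈ L`. If a prefix
`α[n, a)` of `α[n:]` lies in `L'`, then `α[m:]` has type `s e^ω`. Past the first cut, `p * s * r =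
e`, where `p` is the value from `i 0` to `n` and `r` the value from `a` to a later cut. With `g = e
r e` and `q = e p s e` this gives `q g = e`, hence `g q = e` by finiteness
(`mul_eq_idempotent_symm`). So `s e^ω = s (g q)^ω = s g (q g)^ω = s r e^ω`, the type of `α[n:]`.
This is `RecognizesOmega.exists_prefix_values`. A Büchi automaton yields such a `φ` through
`NFA.runCon`. A first-order sentence yields one through `efCon`, the Ehrenfeucht–Fraïssé equivalence
for its quantifier rank, whose classes are first-order definable. -/

/-- The factor of the infinite word `x` between the positions `a` (included) and `b` (excluded). -/
def Stream'.factor {Γ : Type u} (x : Stream' Γ) (a b : ℕ) : List Γ := (x.drop a).take (b - a)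

namespace Stream'

variable {Γ : Type u}

@[simp] theorem length_factor (x : Stream' Γ) (a b : ℕ) : (x.factor a b).length = b - a := by
  simp [factor]

theorem getElem_factor (x : Stream' Γ) (a b i : ℕ) (h : i < (x.factor a b).length) :
    (x.factor a b)[i] = x.get (a + i) := by
  have h' : i < b - a := by simpa using h
  have := getElem?_take (s := x.drop a) h'
  rw [get_drop] at this
  exact (List.getElem?_eq_some_iff.1 this).2

theorem factor_append (x : Stream' Γ) {a b c : ℕ} (hab : a ≤ b) (hbc : b ≤ c) :
    x.factor a b ++ x.factor b c = x.factor a c := by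
  apply List.ext_getElem
  · simp; omega
  · intro i h₁ h₂
    rw [getElem_factor, List.getElem_append]
    split_ifs with h
    · rw [getElem_factor]
    · rw [getElem_factor]
      simp at h h₁ ⊢
      congr 1; omega

theorem factor_drop (x : Stream' Γ) (n a b : ℕ) :
    (x.drop n).factor a b = x.factor (n + a) (n + b) := by
  simp only [factor, drop_drop]
  congr 1; omega

theorem take_drop_eq_factor (x : Stream' Γ) (n m : ℕ) : (x.drop n).take m = x.factor n (n + m) := by
  simp [factor]

end Stream'

/-! ### Cutting into blocks and gluing. -/

section Blocks

variable {s : ℕ → ℕ}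

theorem StrictMono.exists_block (hs : StrictMono s) (h0 : s 0 = 0) (t : ℕ) :
    ∃ i, s i ≤ t ∧ t < s (i + 1) := by
  induction t with
  | zero =>
    have : s 0 < s (0 + 1) := hs (Nat.lt_succ_self 0)
    exact ⟨0, by omega, by omega⟩
  | succ t ih =>
    obtain ⟨i, h₁, h₂⟩ := ih
    by_cases h : t + 1 < s (i + 1)
    · exact ⟨i, by omega, h⟩
    · exact ⟨i + 1, by omega, by have := hs (Nat.lt_succ_self (i + 1)); simp at this; omega⟩

theorem StrictMono.block_unique (hs : StrictMono s) {i j t : ℕ} (hi : s i ≤ t) (hi' : t < s (i + 1))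
    (hj : s j ≤ t) (hj' : t < s (j + 1)) : i = j := by
  have h₁ := hs.lt_iff_lt.1 (hi.trans_lt hj')
  have h₂ := hs.lt_iff_lt.1 (hj.trans_lt hi')
  omega

/-- Functions given on the successive blocks of `ℕ` delimited by `s` can be glued together. -/
theorem StrictMono.exists_glue (hs : StrictMono s) (h0 : s 0 = 0) {X : Type v} (f : ℕ → ℕ → X) :
    ∃ y : ℕ → X, ∀ i j, s i + j < s (i + 1) → y (s i + j) = f i j := by
  choose π h₁ h₂ using hs.exists_block h0
  refine ⟨fun t => f (π t) (t - s (π t)), fun i j h => ?_⟩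
  have : π (s i + j) = i := hs.block_unique (h₁ _) (h₂ _) (by omega) h
  simp [this]

theorem Stream'.exists_concat {Γ : Type u} (w : ℕ → List Γ) (hw : ∀ i, w i ≠ []) :
    ∃ (y : Stream' Γ) (s : ℕ → ℕ), StrictMono s ∧ s 0 = 0 ∧
      ∀ i, y.factor (s i) (s (i + 1)) = w i := by
  -- Only a default for `getD`; it is never read inside a block.
  have : Inhabited Γ := ⟨(w 0).head (hw 0)⟩
  let s : ℕ → ℕ := fun n => ∑ i ∈ Finset.range n, (w i).length
  have hsucc : ∀ n, s (n + 1) = s n + (w n).length := fun n => Finset.sum_range_succ _ _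
  have hs : StrictMono s := strictMono_nat_of_lt_succ fun n => by
    have := List.length_pos_of_ne_nil (hw n)
    rw [hsucc]; omega
  have h0 : s 0 = 0 := rfl
  obtain ⟨y, hy⟩ : ∃ y : Stream' Γ, ∀ i j, s i + j < s (i + 1) →
      y.get (s i + j) = (w i).getD j default := hs.exists_glue h0 _
  refine ⟨y, s, hs, h0, fun i => List.ext_getElem (by rw [Stream'.length_factor, hsucc]; omega)
    fun j h₁ h₂ => ?_⟩
  rw [Stream'.getElem_factor]
  refine (hy i j (by rw [hsucc]; omega)).trans ?_
  simp [h₂]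

end Blocks

/-! ### Ramsey's theorem and finite monoids. -/

/-- The infinite Ramsey theorem for additive colourings. -/
theorem exists_strictMono_const {S : Type v} [Finite S] (f : ℕ → ℕ → S) :
    ∃ (s : ℕ → ℕ) (e : S), StrictMono s ∧ ∀ j k, j < k → f (s j) (s k) = e := by
  let U := Filter.hyperfilter ℕ
  have key : ∀ g : ℕ → S, ∃ c, ∀ᶠ n in (U : Filter ℕ), g n = c := by
    intro g
    obtain ⟨c, -, hc⟩ := (Ultrafilter.eventually_exists_mem_iff (f := U) (is := Set.univ)
      (P := fun c n => g n = c) Set.finite_univ).1 (by simp)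
    exact ⟨c, hc⟩
  -- `c i` is the colour of `f i j` for almost all `j` along the ultrafilter, and `e` the colour `c
  -- i` for almost all `i`; the sequence is then built greedily.
  choose c hc using fun i => key (f i)
  obtain ⟨e, he⟩ := key c
  obtain ⟨s, hs, hs'⟩ := exists_seq_of_forall_finset_exists (fun i => c i = e)
    (fun i j => i < j ∧ f i j = e) (by
      intro t ht
      have h : ∀ᶠ j in (U : Filter ℕ), ∀ i ∈ t, i < j ∧ f i j = e := by
        rw [Filter.eventually_all_finset]
        intro i hi
        have hlt : ∀ᶠ j in (U : Filter ℕ), i < j :=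
          (Nat.hyperfilter_le_atTop) (Filter.eventually_gt_atTop i)
        filter_upwards [hlt, hc i] with j h₁ h₂
        exact ⟨h₁, h₂.trans (ht i hi)⟩
      exact (he.and h).exists)
  exact ⟨s, e, strictMono_nat_of_lt_succ fun n => (hs' n (n + 1) (Nat.lt_succ_self n)).1,
    fun j k h => (hs' j k h).2⟩

/-- The local monoid of a finite monoid at an idempotent is Dedekind-finite. -/
theorem mul_eq_idempotent_symm {S : Type v} [Monoid S] [Finite S] {e q g : S} (he : e * e = e)
    (hg : e * g = g) (hq : q * e = q) (h : q * g = e) : g * q = e := by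
  let T := {x : S // e * x = x}
  -- Left multiplication by `q` undoes `F`, so `F` is injective, hence surjective; the preimage of
  -- `e` turns out to be `q`.
  let F : T → T := fun x => ⟨g * x, by rw [← mul_assoc, hg]⟩
  have hF : Function.Injective F := by
    rintro ⟨x, hx⟩ ⟨y, hy⟩ hxy
    have h₁ : g * x = g * y := congrArg Subtype.val hxy
    have h₂ := congrArg (q * ·) h₁
    simp only [← mul_assoc, h, hx, hy] at h₂
    exact Subtype.ext h₂
  obtain ⟨⟨x, hx⟩, hxe⟩ := Finite.surjective_of_injective hF ⟨e, he⟩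
  have h₁ : g * x = e := congrArg Subtype.val hxe
  have h₂ : x = q := by rw [← hx, ← h, mul_assoc, h₁, hq]
  rw [← h₂, h₁]

/-! ### Recognition by finite monoids and the prefix criterion. -/

/-- The morphism `φ` recognizes the set `L` of infinite words: membership in `L` only depends on
the values under `φ` of the nonempty blocks of a factorization. -/
def RecognizesOmega {Γ : Type u} {S : Type v} [Monoid S] (φ : FreeMonoid Γ →* S)
    (L : Set (Stream' Γ)) : Prop :=
  ∀ (x y : Stream' Γ) (s t : ℕ → ℕ), StrictMono s → StrictMono t → s 0 = 0 → t 0 = 0 →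
    (∀ i, φ (.ofList (x.factor (s i) (s (i + 1)))) = φ (.ofList (y.factor (t i) (t (i + 1))))) →
    x ∈ L → y ∈ L

namespace RecognizesOmega

variable {Γ : Type u} {S : Type v} [Monoid S] {φ : FreeMonoid Γ →* S} {L : Set (Stream' Γ)}

theorem drop_mem (h : RecognizesOmega φ L) {x y : Stream' Γ} {s t : ℕ → ℕ} (hs : StrictMono s)
    (ht : StrictMono t)
    (hst : ∀ i, φ (.ofList (x.factor (s i) (s (i + 1)))) =
      φ (.ofList (y.factor (t i) (t (i + 1)))))
    (hx : x.drop (s 0) ∈ L) : y.drop (t 0) ∈ L := by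
  have hs0 : ∀ i, s 0 + (s i - s 0) = s i := fun i => by
    have := hs.monotone (Nat.zero_le i); omega
  have ht0 : ∀ i, t 0 + (t i - t 0) = t i := fun i => by
    have := ht.monotone (Nat.zero_le i); omega
  refine h _ _ (fun i => s i - s 0) (fun i => t i - t 0) ?_ ?_ (by simp) (by simp) ?_ hx
  · intro i j hij
    have := hs hij; have := hs0 i; have := hs0 j; simp only; omega
  · intro i j hij
    have := ht hij; have := ht0 i; have := ht0 j; simp only; omega
  · intro i
    simp only [Stream'.factor_drop, hs0, ht0, hst]

/-- Every suffix of `α` far enough out is classified by the value under `φ` of one of its finite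
prefixes. -/
theorem exists_prefix_values [Finite S] (h : RecognizesOmega φ L) (α : Stream' Γ) :
    ∃ (P : Set S) (N : ℕ), ∀ n, N ≤ n →
      (α.drop n ∈ L ↔ ∃ m, φ (.ofList ((α.drop n).take m)) ∈ P) := by
  let f : ℕ → ℕ → S := fun a b => φ (.ofList (α.factor a b))
  have f_mul : ∀ {a b c}, a ≤ b → b ≤ c → f a b * f b c = f a c := fun hab hbc => by
    simp only [f, ← map_mul, ← FreeMonoid.ofList_append, α.factor_append hab hbc]
  obtain ⟨i, e, hi, hie⟩ := exists_strictMono_const f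
  have lt_i : ∀ {a b}, a < b → i a < i b := fun hab => hi hab
  have he : e * e = e := by
    have := f_mul (lt_i Nat.zero_lt_one).le (lt_i Nat.one_lt_two).le
    rwa [hie 0 1 (by simp), hie 1 2 (by simp), hie 0 2 (by simp)] at this
  refine ⟨{s | s * e = s ∧ ∃ m k, m < i k ∧ α.drop m ∈ L ∧ f m (i k) = s}, i 0,
    fun n hn => ⟨fun hL => ?_, ?_⟩⟩
  -- The prefix contains one full block after the cut `i (n + 1)`, so its value absorbs `e` on the
  -- right.
  · have h₁ : n < i (n + 1) := hi.le_apply.trans_lt (lt_i (Nat.lt_succ_self n))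
    have h₂ : i (n + 1) < i (n + 2) := lt_i (Nat.lt_succ_self _)
    have h₃ : f n (i (n + 2)) * e = f n (i (n + 2)) := by
      rw [← f_mul h₁.le h₂.le, hie _ _ (Nat.lt_succ_self _), mul_assoc, he]
    refine ⟨i (n + 2) - n, ?_⟩
    rw [Stream'.take_drop_eq_factor, Nat.add_sub_cancel' (h₁.trans h₂).le]
    exact ⟨h₃, n, n + 2, h₁.trans h₂, hL, rfl⟩
  · rintro ⟨m', hse, m, k, hmk, hmL, hs⟩
    rw [Stream'.take_drop_eq_factor] at hse hs
    set a := n + m' with ha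
    change f n a * e = f n a at hse
    change f m (i k) = f n a at hs
    have h₁ : a < i (a + 1) := hi.le_apply.trans_lt (lt_i (Nat.lt_succ_self a))
    have h₂ : i (a + 1) < i (a + 2) := lt_i (Nat.lt_succ_self _)
    have hpsr : f (i 0) n * f n a * f a (i (a + 1)) = e := by
      rw [f_mul hn (by omega), f_mul (by omega) h₁.le, hie _ _ (Nat.succ_pos a)]
    let wu := α.factor m (i k)
    let we := α.factor (i 0) (i 1)
    -- Padding with `we` keeps the blocks nonempty and puts their values in the local monoid at `e`.
    let wg := we ++ α.factor a (i (a + 1)) ++ we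
    let wq := we ++ α.factor (i 0) n ++ α.factor n a ++ we
    have hwe : we ≠ [] := by
      have := lt_i Nat.zero_lt_one
      apply List.ne_nil_of_length_pos; simp [we]; omega
    have hφe : φ (.ofList we) = e := hie 0 1 Nat.zero_lt_one
    have hφu : φ (.ofList wu) = f n a := hs
    have hφg : φ (.ofList wg) = e * f a (i (a + 1)) * e := by
      simp [wg, FreeMonoid.ofList_append, hφe, f, mul_assoc]
    have hφq : φ (.ofList wq) = e * (f (i 0) n * f n a) * e := by
      simp [wq, FreeMonoid.ofList_append, hφe, f, mul_assoc]
    have hqg : φ (.ofList wq) * φ (.ofList wg) = e := by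
      rw [hφq, hφg]
      calc _ = e * (f (i 0) n * (f n a * e * e)) * f a (i (a + 1)) * e := by simp only [mul_assoc]
        _ = e * (f (i 0) n * f n a * f a (i (a + 1))) * e := by
          rw [hse, hse]; simp only [mul_assoc]
        _ = e := by rw [hpsr, he, he]
    have hgq : φ (.ofList wg) * φ (.ofList wq) = e := by
      apply mul_eq_idempotent_symm he _ _ hqg
      · rw [hφg, ← mul_assoc, ← mul_assoc, he]
      · rw [hφq, mul_assoc _ e e, he]
    obtain ⟨y, s, hsm, hs0, hy⟩ := Stream'.exists_concat
      (fun j => if j = 0 then wu else if j % 2 = 1 then wg else wq) (by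
        intro j
        split_ifs
        · apply List.ne_nil_of_length_pos; simp [wu]; omega
        · simp [wg, hwe]
        · simp [wq, hwe])
    have hy2 : ∀ j, φ (.ofList (y.factor (s j) (s (j + 2)))) =
        φ (.ofList (y.factor (s j) (s (j + 1)))) *
          φ (.ofList (y.factor (s (j + 1)) (s (j + 2)))) := fun j => by
      rw [← map_mul, ← FreeMonoid.ofList_append, y.factor_append (hsm.monotone (by omega))
        (hsm.monotone (by omega))]
    -- Bracket `y` as `u (g q) (g q) ...`, which matches `α[m:]` cut at `i k, i (k + 1), ...`.
    have hyL : y.drop (s 0) ∈ L := by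
      refine h.drop_mem (x := α) (s := fun j => if j = 0 then m else i (k + j - 1))
        (t := fun j => s (if j = 0 then 0 else 2 * j - 1)) ?_ ?_ ?_ hmL
      · refine strictMono_nat_of_lt_succ fun j => ?_
        rcases j with _ | j
        · simpa using hmk
        · simpa using lt_i (by omega)
      · refine hsm.comp (strictMono_nat_of_lt_succ fun j => ?_)
        rcases j with _ | j <;> simp; omega
      · intro j
        rcases j with _ | j
        · simp [hy, wu]
        · have : 2 * (j + 1 + 1) - 1 = 2 * (j + 1) - 1 + 2 := by omega
          simp only [Nat.add_eq_zero_iff, one_ne_zero, and_false, if_false, this, hy2, hy]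
          have h₁ : (2 * (j + 1) - 1) % 2 = 1 := by omega
          have h₂ : (2 * (j + 1) - 1 + 1) % 2 = 0 := by omega
          have h₃ : 2 * (j + 1) - 1 ≠ 0 := by omega
          simp only [h₁, h₂, h₃, if_true, if_false, zero_ne_one, hgq]
          exact hie _ _ (by omega)
    -- Bracket `y` as `(u g) (q g) (q g) ...`, which matches `α[n:]` cut at `i (a + 2), i (a + 3),
    -- ...`.
    refine h.drop_mem (x := y) (s := fun j => s (2 * j))
      (t := fun j => if j = 0 then n else i (a + 1 + j)) ?_ ?_ ?_ hyL
    · exact hsm.comp fun _ _ _ => by omega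
    · refine strictMono_nat_of_lt_succ fun j => ?_
      rcases j with _ | j
      · simpa using (by omega : n < i (a + 2))
      · simpa using lt_i (by omega)
    · intro j
      have : 2 * (j + 1) = 2 * j + 2 := by omega
      simp only [this, hy2, hy]
      rcases j with _ | j
      · simp only [mul_zero, if_true, zero_add, one_ne_zero, if_false, Nat.one_mod, hφu, hφg]
        change _ = f n (i (a + 2))
        rw [← f_mul (b := i (a + 1)) (by omega) h₂.le, ← f_mul (a := n) (b := a) (by omega) h₁.le,
          hie _ _ (Nat.lt_succ_self _)]
        simp only [← mul_assoc, hse]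
      · have h₁ : (2 * (j + 1)) % 2 = 0 := by omega
        have h₂ : (2 * (j + 1) + 1) % 2 = 1 := by omega
        simp only [h₁, h₂, if_true, if_false, zero_ne_one, Nat.add_eq_zero_iff, one_ne_zero,
          and_false, mul_eq_zero, OfNat.ofNat_ne_zero, or_false, hqg]
        exact (hie _ _ (by omega)).symm

end RecognizesOmega

theorem Language.isRegular_of_finite_monoid {Γ : Type u} {S : Type v} [Monoid S] [Finite S]
    (φ : FreeMonoid Γ →* S) (P : Set S) :
    Language.IsRegular ({w | φ (.ofList w) ∈ P} : Language Γ) := by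
  have := Fintype.ofFinite S
  let M : DFA Γ S := ⟨fun s a => s * φ (.of a), 1, P⟩
  refine Language.isRegular_iff.2 ⟨S, this, M, ?_⟩
  have h : ∀ (w : List Γ) (s : S), M.evalFrom s w = s * φ (.ofList w) := by
    intro w
    induction w with
    | nil => intro s; simp [DFA.evalFrom]
    | cons a w ih =>
      intro s
      rw [DFA.evalFrom_cons, ih, FreeMonoid.ofList_cons, map_mul, ← mul_assoc]
  ext w
  change M.evalFrom 1 w ∈ P ↔ _
  rw [h, one_mul]
  rfl

/-! ### The finite monoid of a Büchi automaton. -/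

namespace NFA

variable {Γ : Type u} {σ : Type v} (M : NFA Γ σ)

/-- `M.RunOn b w p q`: there is a run of `M` on the finite word `w` from `p` to `q`, which visits an
accepting state before its end if `b` is `true`. -/
def RunOn (b : Bool) (w : List Γ) (p q : σ) : Prop :=
  ∃ ρ : ℕ → σ, ρ 0 = p ∧ ρ w.length = q ∧
    (∀ (i : ℕ) (h : i < w.length), ρ (i + 1) ∈ M.step (ρ i) w[i]) ∧
    (b = true → ∃ i < w.length, ρ i ∈ M.accept)

variable {M}

theorem runOn_append {b : Bool} {u v : List Γ} {p q : σ} :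
    M.RunOn b (u ++ v) p q ↔
      ∃ r b₁ b₂, (b = true → b₁ = true ∨ b₂ = true) ∧ M.RunOn b₁ u p r ∧ M.RunOn b₂ v r q := by
  classical
  constructor
  · rintro ⟨ρ, h0, h1, hstep, hacc⟩
    refine ⟨ρ u.length, decide (∃ i < u.length, ρ i ∈ M.accept),
      decide (∃ i < v.length, ρ (u.length + i) ∈ M.accept), fun hb => ?_,
      ⟨ρ, h0, rfl, fun i h => ?_, by simp⟩,
      ⟨fun i => ρ (u.length + i), rfl, by simpa using h1, fun i h => ?_, by simp⟩⟩
    · obtain ⟨i, hi, hi'⟩ := hacc hb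
      simp only [List.length_append] at hi
      by_cases h : i < u.length
      · exact .inl (by simpa using ⟨i, h, hi'⟩)
      · refine .inr (decide_eq_true ⟨i - u.length, by omega, ?_⟩)
        rwa [Nat.add_sub_cancel' (by omega)]
    · have := hstep i (by simp; omega)
      rwa [List.getElem_append_left h] at this
    · have := hstep (u.length + i) (by simpa using h)
      rw [List.getElem_append_right (by omega)] at this
      simpa [add_assoc] using this
  · rintro ⟨r, b₁, b₂, hb, ⟨ρ₁, h₁0, h₁1, h₁s, h₁a⟩, ⟨ρ₂, h₂0, h₂1, h₂s, h₂a⟩⟩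
    let ρ : ℕ → σ := fun i => if i < u.length then ρ₁ i else ρ₂ (i - u.length)
    have hρ₁ : ∀ i ≤ u.length, ρ i = ρ₁ i := fun i hi => by
      by_cases h : i < u.length
      · simp [ρ, h]
      · obtain rfl : i = u.length := by omega
        simp [ρ, h₂0, h₁1]
    have hρ₂ : ∀ i, ρ (u.length + i) = ρ₂ i := fun i => by simp [ρ]
    refine ⟨ρ, by rw [hρ₁ 0 (Nat.zero_le _), h₁0], by rw [List.length_append, hρ₂, h₂1],
      fun i h => ?_, fun h => ?_⟩
    · by_cases hi : i < u.length
      · rw [hρ₁ _ hi, hρ₁ _ hi.le, List.getElem_append_left hi]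
        exact h₁s i hi
      · obtain ⟨j, rfl⟩ := Nat.exists_eq_add_of_le (not_lt.1 hi)
        rw [List.getElem_append_right (by omega), add_assoc, hρ₂, hρ₂]
        simp only [Nat.add_sub_cancel_left]
        exact h₂s j (by simpa using h)
    · rcases hb h with h | h
      · obtain ⟨i, hi, hi'⟩ := h₁a h
        exact ⟨i, by simp; omega, by rwa [hρ₁ i hi.le]⟩
      · obtain ⟨i, hi, hi'⟩ := h₂a h
        exact ⟨u.length + i, by simpa using hi, by rwa [hρ₂]⟩

variable (M)

/-- The congruence of words that allow the same runs between states of `M`. -/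
def runCon : Con (FreeMonoid Γ) where
  toSetoid := Setoid.ker fun (w : FreeMonoid Γ) b p q => M.RunOn b w.toList p q
  mul' {w x y z} h₁ h₂ := by
    have h₁ : (fun b p q => M.RunOn b w.toList p q) = fun b p q => M.RunOn b x.toList p q := h₁
    have h₂ : (fun b p q => M.RunOn b y.toList p q) = fun b p q => M.RunOn b z.toList p q := h₂
    simp only [funext_iff] at h₁ h₂
    change (fun b p q => M.RunOn b (w * y).toList p q) = fun b p q => M.RunOn b (x * z).toList p q
    funext b p q
    simp only [FreeMonoid.toList_mul, runOn_append, h₁, h₂]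

variable {M}

theorem runCon_iff {w x : FreeMonoid Γ} :
    M.runCon w x ↔ ∀ b p q, M.RunOn b w.toList p q ↔ M.RunOn b x.toList p q := by
  change (fun b p q => M.RunOn b w.toList p q) = (fun b p q => M.RunOn b x.toList p q) ↔ _
  simp [funext_iff]

instance [Finite σ] : Finite M.runCon.Quotient :=
  Finite.of_injective _ (Setoid.kerLift_injective
    fun (w : FreeMonoid Γ) b p q => M.RunOn b w.toList p q)

variable (M)

/-- An accepting run on `x` is transferred block by block: each block of `y` admits a run with the
same end states that meets an accepting state whenever the original does. -/
theorem recognizesOmega_runCon : RecognizesOmega M.runCon.mk' M.omegaAccepts := by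
  classical
  rintro x y s t hs ht hs0 ht0 hst ⟨ρ, hρ0, hρs, hρa⟩
  have hpath : ∀ i, M.RunOn (decide (∃ j, s i + j < s (i + 1) ∧ ρ (s i + j) ∈ M.accept))
      (y.factor (t i) (t (i + 1))) (ρ (s i)) (ρ (s (i + 1))) := fun i => by
    have hi := hs.monotone (Nat.le_succ i)
    refine (runCon_iff.1 ((Con.eq _).1 (hst i)) _ _ _).1
      ⟨fun j => ρ (s i + j), rfl, ?_, fun j h => ?_, fun h => ?_⟩
    · simp [Nat.add_sub_cancel' hi]
    · simp only [FreeMonoid.toList_ofList, Stream'.getElem_factor]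
      exact hρs _
    · obtain ⟨j, hj, hj'⟩ := of_decide_eq_true h
      exact ⟨j, by simp; omega, hj'⟩
  choose r hr0 hr1 hrs hra using hpath
  obtain ⟨ρ', hρ'⟩ := ht.exists_glue ht0 r
  -- The right end of a block is included because consecutive local runs share that state.
  have hρ'le : ∀ i j, t i + j ≤ t (i + 1) → ρ' (t i + j) = r i j := fun i j h => by
    rcases h.lt_or_eq with h | h
    · exact hρ' i j h
    · have h' := hρ' (i + 1) 0 (ht (Nat.lt_succ_self _))
      rw [add_zero, hr0, ← hr1 i] at h'
      rw [h, h']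
      congr 1; simp; omega
  refine ⟨ρ', ?_, fun τ => ?_, ?_⟩
  · have := hρ' 0 0 (ht (Nat.lt_succ_self _))
    rw [ht0, hr0, hs0] at this
    rwa [this]
  · obtain ⟨i, h₁, h₂⟩ := ht.exists_block ht0 τ
    obtain ⟨j, rfl⟩ := Nat.exists_eq_add_of_le h₁
    rw [add_assoc, hρ'le i j h₂.le, hρ'le i (j + 1) h₂]
    have := hrs i j (by simp; omega)
    rwa [Stream'.getElem_factor] at this
  · rw [Filter.frequently_atTop] at hρa ⊢
    intro n
    obtain ⟨τ, hτ, hτa⟩ := hρa (s n)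
    obtain ⟨i, h₁, h₂⟩ := hs.exists_block hs0 τ
    obtain ⟨j, rfl⟩ := Nat.exists_eq_add_of_le h₁
    obtain ⟨k, hk, hk'⟩ := hra i (by simpa using ⟨j, h₂, hτa⟩)
    rw [Stream'.length_factor] at hk
    have hn : n < i + 1 := hs.lt_iff_lt.1 (hτ.trans_lt h₂)
    have hi : i ≤ t i := ht.le_apply
    exact ⟨t i + k, by omega, by rwa [hρ' i k (by omega)]⟩

end NFA

/-! ### Ehrenfeucht–Fraïssé games. -/

/-- The duplicator wins the `k`-round Ehrenfeucht–Fraïssé game between the labelled linear orders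
`(P, f)` and `(Q, g)`, starting from the position in which the pairs in `R` have been chosen. -/
def EFEquiv {Γ : Type u} {P Q : Type} [LT P] [LT Q] (f : P → Γ) (g : Q → Γ) :
    ℕ → Set (P × Q) → Prop
  | 0, R => ∀ x ∈ R, f x.1 = g x.2 ∧ ∀ y ∈ R, x.1 < y.1 ↔ x.2 < y.2
  | k + 1, R =>
    (∀ p, ∃ q, EFEquiv f g k (insert (p, q) R)) ∧ ∀ q, ∃ p, EFEquiv f g k (insert (p, q) R)

namespace EFEquiv

variable {Γ : Type u} {P Q T : Type} {k : ℕ}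

section Basic

variable [LT P] [LT Q] [LT T] {f : P → Γ} {g : Q → Γ} {h : T → Γ} {R R' : Set (P × Q)}

theorem mono (hR : R' ⊆ R) (H : EFEquiv f g k R) : EFEquiv f g k R' := by
  induction k generalizing R R' with
  | zero => exact fun x hx => ⟨(H x (hR hx)).1, fun y hy => (H x (hR hx)).2 y (hR hy)⟩
  | succ k ih =>
    exact ⟨fun p => (H.1 p).imp fun q => ih (Set.insert_subset_insert hR),
      fun q => (H.2 q).imp fun p => ih (Set.insert_subset_insert hR)⟩

theorem zero_of (H : EFEquiv f g k R) : EFEquiv f g 0 R := by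
  induction k generalizing R with
  | zero => exact H
  | succ k ih =>
    intro x hx
    obtain ⟨q, hq⟩ := H.1 x.1
    exact (ih hq).mono (Set.subset_insert _ _) x hx

theorem of_succ (H : EFEquiv f g (k + 1) R) : EFEquiv f g k R := by
  induction k generalizing R with
  | zero => exact H.zero_of
  | succ k ih =>
    exact ⟨fun p => (H.1 p).imp fun q => ih, fun q => (H.2 q).imp fun p => ih⟩

theorem refl (f : P → Γ) (k : ℕ) {R : Set (P × P)} (hR : ∀ x ∈ R, x.1 = x.2) :
    EFEquiv f f k R := by
  induction k generalizing R with
  | zero => exact fun x hx => ⟨by rw [hR x hx], fun y hy => by rw [hR x hx, hR y hy]⟩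
  | succ k ih =>
    have : ∀ p, ∀ x ∈ insert (p, p) R, x.1 = x.2 := by
      rintro p x (rfl | hx)
      exacts [rfl, hR x hx]
    exact ⟨fun p => ⟨p, ih (this p)⟩, fun p => ⟨p, ih (this p)⟩⟩

theorem symm (H : EFEquiv f g k R) : EFEquiv g f k (Prod.swap ⁻¹' R) := by
  induction k generalizing R with
  | zero =>
    exact fun x hx => ⟨(H _ hx).1.symm, fun y hy => ((H _ hx).2 _ hy).symm⟩
  | succ k ih =>
    have hins : ∀ p q, insert (q, p) (Prod.swap ⁻¹' R) = Prod.swap ⁻¹' (insert (p, q) R) := by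
      rintro p q
      ext ⟨a, b⟩
      simp [and_comm]
    exact ⟨fun q => (H.2 q).imp fun p hp => hins p q ▸ ih hp,
      fun p => (H.1 p).imp fun q hq => hins p q ▸ ih hq⟩

theorem trans {R₁ : Set (P × Q)} {R₂ : Set (Q × T)} {R₃ : Set (P × T)}
    (H₁ : EFEquiv f g k R₁) (H₂ : EFEquiv g h k R₂)
    (hR : ∀ p t, (p, t) ∈ R₃ → ∃ q, (p, q) ∈ R₁ ∧ (q, t) ∈ R₂) : EFEquiv f h k R₃ := by
  induction k generalizing R₁ R₂ R₃ with
  | zero =>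
    rintro ⟨p, t⟩ hx
    obtain ⟨q, h₁, h₂⟩ := hR p t hx
    refine ⟨(H₁ _ h₁).1.trans (H₂ _ h₂).1, ?_⟩
    rintro ⟨p', t'⟩ hx'
    obtain ⟨q', h₁', h₂'⟩ := hR p' t' hx'
    exact ((H₁ _ h₁).2 _ h₁').trans ((H₂ _ h₂).2 _ h₂')
  | succ k ih =>
    have hins : ∀ p q t, ∀ p' t', (p', t') ∈ insert (p, t) R₃ →
        ∃ q', (p', q') ∈ insert (p, q) R₁ ∧ (q', t') ∈ insert (q, t) R₂ := by
      rintro p q t p' t' (hx | hx)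
      · obtain ⟨rfl, rfl⟩ := Prod.mk.inj hx
        exact ⟨q, .inl rfl, .inl rfl⟩
      · obtain ⟨q', h₁, h₂⟩ := hR p' t' hx
        exact ⟨q', .inr h₁, .inr h₂⟩
    constructor
    · intro p
      obtain ⟨q, hq⟩ := H₁.1 p
      obtain ⟨t, ht⟩ := H₂.1 q
      exact ⟨t, ih hq ht (hins p q t)⟩
    · intro t
      obtain ⟨q, hq⟩ := H₂.2 t
      obtain ⟨p, hp⟩ := H₁.2 q
      exact ⟨p, ih hp hq (hins p q t)⟩

end Basic

section Sum

/-- The composition lemma: the duplicator wins on ordered sums if it wins on each summand. -/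
theorem sum {ι : Type} [LinearOrder ι] [LinearOrder P] [LinearOrder Q] {f : P → Γ} {g : Q → Γ}
    {A B : ι → Type} [∀ i, LinearOrder (A i)] [∀ i, LinearOrder (B i)]
    {fA : ∀ i, A i → Γ} {gB : ∀ i, B i → Γ} (a : ∀ i, A i → P) (b : ∀ i, B i → Q)
    (hfa : ∀ i p, f (a i p) = fA i p) (hgb : ∀ i q, g (b i q) = gB i q)
    (ha : ∀ i, StrictMono (a i)) (hb : ∀ i, StrictMono (b i))
    (ha' : ∀ i j, i < j → ∀ p p', a i p < a j p') (hb' : ∀ i j, i < j → ∀ q q', b i q < b j q')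
    (hsa : ∀ x, ∃ i p, a i p = x) (hsb : ∀ y, ∃ i q, b i q = y)
    {R : Set (P × Q)} (hR : ∀ x y, (x, y) ∈ R → ∃ i p q, a i p = x ∧ b i q = y)
    (H : ∀ i, EFEquiv (fA i) (gB i) k {z | (a i z.1, b i z.2) ∈ R}) : EFEquiv f g k R := by
  have hia : ∀ {i j p p'}, a i p = a j p' → i = j := fun {i j p p'} h => by
    rcases lt_trichotomy i j with hij | hij | hij
    · exact absurd h (ha' i j hij p p').ne
    · exact hij
    · exact absurd h (ha' j i hij p' p).ne'
  induction k generalizing R with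
  | zero =>
    rintro ⟨x, y⟩ hx
    obtain ⟨i, p, q, rfl, rfl⟩ := hR x y hx
    refine ⟨by rw [hfa, hgb]; exact (H i (p, q) hx).1, ?_⟩
    rintro ⟨x', y'⟩ hx'
    obtain ⟨j, p', q', rfl, rfl⟩ := hR x' y' hx'
    rcases lt_trichotomy i j with hij | rfl | hij
    · exact iff_of_true (ha' i j hij p p') (hb' i j hij q q')
    · exact (ha i).lt_iff_lt.trans
        (((H i (p, q) hx).2 (p', q') hx').trans (hb i).lt_iff_lt.symm)
    · exact iff_of_false (ha' j i hij p' p).not_gt (hb' j i hij q' q).not_gt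
  | succ k ih =>
    -- The duplicator answers inside the summand where the spoiler played; the other summands merely
    -- forgo a round.
    have step : ∀ i p q,
        EFEquiv (fA i) (gB i) k (insert (p, q) {z | (a i z.1, b i z.2) ∈ R}) →
        EFEquiv f g k (insert (a i p, b i q) R) := by
      intro i p q h
      apply ih
      · rintro x y (hxy | hxy)
        · obtain ⟨rfl, rfl⟩ := Prod.mk.inj hxy
          exact ⟨i, p, q, rfl, rfl⟩
        · exact hR x y hxy
      · intro j
        by_cases hij : i = j
        · subst hij
          refine h.mono ?_
          rintro ⟨p', q'⟩ (hz | hz)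
          · obtain ⟨h₁, h₂⟩ := Prod.mk.inj hz
            exact .inl (Prod.ext ((ha i).injective h₁) ((hb i).injective h₂))
          · exact .inr hz
        · refine (H j).of_succ.mono ?_
          rintro ⟨p', q'⟩ (hz | hz)
          · exact absurd (hia (Prod.mk.inj hz).1).symm hij
          · exact hz
    constructor
    · intro x
      obtain ⟨i, p, rfl⟩ := hsa x
      obtain ⟨q, hq⟩ := (H i).1 p
      exact ⟨b i q, step i p q hq⟩
    · intro y
      obtain ⟨i, q, rfl⟩ := hsb y
      obtain ⟨p, hp⟩ := (H i).2 q
      exact ⟨a i p, step i p q hp⟩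

end Sum

end EFEquiv

open FirstOrder Language BoundedFormula

/-- The maximal number of nested quantifiers of a formula. -/
def FirstOrder.Language.BoundedFormula.quantifierRank {L : Language} {α : Type v} :
    ∀ {n : ℕ}, L.BoundedFormula α n → ℕ
  | _, falsum => 0
  | _, equal _ _ => 0
  | _, rel _ _ => 0
  | _, imp φ ψ => max φ.quantifierRank ψ.quantifierRank
  | _, all φ => φ.quantifierRank + 1

/-! ### Games and formulas of bounded quantifier rank. -/

section WordFormula

variable {Γ : Type u} {P Q : Type} [LinearOrder P] [LinearOrder Q] {n : ℕ}

/-- Satisfaction of a formula by a tuple of positions of a labelled linear order. -/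
def WordRealize (f : P → Γ) (φ : (wordLanguage Γ).BoundedFormula Empty n) (a : Fin n → P) : Prop :=
  @BoundedFormula.Realize (wordLanguage Γ) P (wordStructure f) Empty n φ Empty.elim a

theorem wordLanguage_term_eq_var (t : (wordLanguage Γ).Term (Empty ⊕ Fin n)) :
    ∃ i, t = Term.var (.inr i) := by
  cases t with
  | var x => rcases x with x | i; exacts [x.elim, ⟨i, rfl⟩]
  | func g _ => exact Empty.elim g

theorem EFEquiv.wordRealize_iff {f : P → Γ} {g : Q → Γ}
    (φ : (wordLanguage Γ).BoundedFormula Empty n) {k : ℕ} (hk : φ.quantifierRank ≤ k)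
    {R : Set (P × Q)} (H : EFEquiv f g k R) {a : Fin n → P} {b : Fin n → Q}
    (hab : ∀ i, (a i, b i) ∈ R) : WordRealize f φ a ↔ WordRealize g φ b := by
  induction φ generalizing k R with
  | falsum => exact Iff.rfl
  | equal t₁ t₂ =>
    obtain ⟨i, rfl⟩ := wordLanguage_term_eq_var t₁
    obtain ⟨j, rfl⟩ := wordLanguage_term_eq_var t₂
    change a i = a j ↔ b i = b j
    have h₁ := (H.zero_of _ (hab i)).2 _ (hab j)
    have h₂ := (H.zero_of _ (hab j)).2 _ (hab i)
    simp only at h₁ h₂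
    -- The game tests only `<`; equality is recovered from trichotomy.
    rw [← not_iff_not, ← ne_eq, ← ne_eq, ne_iff_lt_or_gt, ne_iff_lt_or_gt, h₁, h₂]
  | rel r ts =>
    cases r with
    | lt =>
      obtain ⟨i, hi⟩ := wordLanguage_term_eq_var (ts 0)
      obtain ⟨j, hj⟩ := wordLanguage_term_eq_var (ts 1)
      change @Term.realize _ _ (wordStructure f) _ _ (ts 0) <
          @Term.realize _ _ (wordStructure f) _ _ (ts 1) ↔
        @Term.realize _ _ (wordStructure g) _ _ (ts 0) <
          @Term.realize _ _ (wordStructure g) _ _ (ts 1)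
      rw [hi, hj]
      exact (H.zero_of _ (hab i)).2 _ (hab j)
    | letter c =>
      obtain ⟨i, hi⟩ := wordLanguage_term_eq_var (ts 0)
      change f (@Term.realize _ _ (wordStructure f) _ _ (ts 0)) = c ↔
        g (@Term.realize _ _ (wordStructure g) _ _ (ts 0)) = c
      rw [hi]
      change f (a i) = c ↔ g (b i) = c
      rw [(H.zero_of _ (hab i)).1]
  | imp φ ψ ih₁ ih₂ =>
    exact imp_congr (ih₁ ((le_max_left _ _).trans hk) H hab)
      (ih₂ ((le_max_right _ _).trans hk) H hab)
  | all φ ih =>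
    obtain ⟨k, rfl⟩ := Nat.exists_eq_add_of_le' ((Nat.le_add_left 1 _).trans hk)
    have hk' : φ.quantifierRank ≤ k := Nat.le_of_succ_le_succ hk
    have hsnoc : ∀ p q i, (Fin.snoc (α := fun _ => P) a p i, Fin.snoc (α := fun _ => Q) b q i) ∈
        insert (p, q) R := by
      intro p q i
      refine Fin.lastCases ?_ (fun j => ?_) i
      · simp
      · simpa using .inr (hab j)
    constructor
    · intro h q
      obtain ⟨p, hp⟩ := H.2 q
      exact (ih hk' hp (hsnoc p q)).1 (h p)
    · intro h p
      obtain ⟨q, hq⟩ := H.1 p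
      exact (ih hk' hq (hsnoc p q)).2 (h q)

/-- Finitely many formulas decide the `k`-round Ehrenfeucht–Fraïssé game. -/
theorem exists_finite_formulas (Γ : Type u) [Finite Γ] (k n : ℕ) :
    ∃ (ι : Type u) (_ : Finite ι) (φ : ι → (wordLanguage Γ).BoundedFormula Empty n),
      ∀ {P Q : Type} [LinearOrder P] [LinearOrder Q] (f : P → Γ) (g : Q → Γ)
        (a : Fin n → P) (b : Fin n → Q),
        (∀ i, WordRealize f (φ i) a ↔ WordRealize g (φ i) b) →
        EFEquiv f g k (Set.range fun i => (a i, b i)) := by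
  induction k generalizing n with
  | zero =>
    refine ⟨(Fin n × Γ) ⊕ (Fin n × Fin n), inferInstance,
      Sum.elim (fun x => rel (L := wordLanguage Γ) (WordRel.letter x.2) fun _ => .var (.inr x.1))
        (fun x => rel (L := wordLanguage Γ) WordRel.lt ![.var (.inr x.1), .var (.inr x.2)]), ?_⟩
    rintro P Q _ _ f g a b h _ ⟨i, rfl⟩
    constructor
    · exact ((h (.inl (i, f (a i)))).1 rfl).symm
    · rintro _ ⟨j, rfl⟩
      exact h (.inr (i, j))
  | succ k ih =>
    classical
    obtain ⟨ι, _, φ, hφ⟩ := ih (n + 1)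
    -- Hintikka formulas: `χ s` says that some next move satisfies exactly those `φ i` with `i ∈ s`.
    let χ : Set ι → (wordLanguage Γ).BoundedFormula Empty n := fun s =>
      (BoundedFormula.iInf fun i => if i ∈ s then φ i else (φ i).not).ex
    have hχ : ∀ {P : Type} [LinearOrder P] (f : P → Γ) (a : Fin n → P) (s : Set ι),
        WordRealize f (χ s) a ↔
          ∃ p, ∀ i, i ∈ s ↔ WordRealize f (φ i) (Fin.snoc (α := fun _ => P) a p) := by
      intro P _ f a s
      let := wordStructure f
      simp only [WordRealize, χ, realize_ex, realize_iInf]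
      refine exists_congr fun p => forall_congr' fun i => ?_
      by_cases hi : i ∈ s <;> simp [hi]
    refine ⟨Set ι, inferInstance, χ, fun {P Q} _ _ f g a b h => ?_⟩
    have hrange : ∀ p q, insert (p, q) (Set.range fun i => (a i, b i)) ⊆
        Set.range fun i => (Fin.snoc (α := fun _ => P) a p i, Fin.snoc (α := fun _ => Q) b q i) := by
      rintro p q _ (rfl | ⟨i, rfl⟩)
      · exact ⟨Fin.last n, by simp⟩
      · exact ⟨i.castSucc, by simp⟩
    constructor
    · intro p
      obtain ⟨q, hq⟩ := (hχ g b _).1 ((h {i | WordRealize f (φ i) (Fin.snoc (α := fun _ => P) a p)}).1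
        ((hχ f a _).2 ⟨p, fun _ => Iff.rfl⟩))
      exact ⟨q, (hφ f g _ _ hq).mono (hrange p q)⟩
    · intro q
      obtain ⟨p, hp⟩ := (hχ f a _).1 ((h {i | WordRealize g (φ i) (Fin.snoc (α := fun _ => Q) b q)}).2
        ((hχ g b _).2 ⟨q, fun _ => Iff.rfl⟩))
      exact ⟨p, (hφ f g _ _ fun i => (hp i).symm).mono (hrange p q)⟩

end WordFormula

/-! ### The finite monoid of a first-order sentence. -/

section WordCongruence

variable {Γ : Type u}

theorem finiteWordSatisfies_iff {w : List Γ} {φ : (wordLanguage Γ).Sentence} :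
    FiniteWordSatisfies w φ ↔ WordRealize w.get φ Fin.elim0 := by
  simp only [FiniteWordSatisfies, Sentence.Realize, Formula.Realize, WordRealize]
  exact iff_of_eq (congrArg₂ _ (Subsingleton.elim _ _) (Subsingleton.elim _ _))

theorem omegaWordSatisfies_iff {x : Stream' Γ} {φ : (wordLanguage Γ).Sentence} :
    OmegaWordSatisfies x φ ↔ WordRealize x.get φ Fin.elim0 := by
  simp only [OmegaWordSatisfies, Sentence.Realize, Formula.Realize, WordRealize]
  exact iff_of_eq (congrArg₂ _ (Subsingleton.elim _ _) (Subsingleton.elim _ _))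

theorem EFEquiv.append {k : ℕ} {u u' w w' : List Γ} (hu : EFEquiv u.get u'.get k ∅)
    (hw : EFEquiv w.get w'.get k ∅) : EFEquiv (u ++ w).get (u' ++ w').get k ∅ := by
  let part : List Γ → List Γ → Bool → List Γ := fun u w i => bif i then w else u
  let emb : ∀ (u w : List Γ) (i : Bool), Fin (part u w i).length → Fin (u ++ w).length :=
    fun u w i => match i with
      | false => fun p => ⟨p, by
          have : (p : ℕ) < u.length := p.2
          simp only [List.length_append]; omega⟩
      | true => fun p => ⟨u.length + p, by
          have : (p : ℕ) < w.length := p.2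
          simp only [List.length_append]; omega⟩
  have hget : ∀ (u w : List Γ) (i : Bool) p, (u ++ w).get (emb u w i p) = (part u w i).get p := by
    rintro u w (_ | _) p
    · have : (p : ℕ) < u.length := p.2
      simp [emb, part, this]
    · simp [emb, part]
  have hmono : ∀ (u w : List Γ) (i : Bool), StrictMono (emb u w i) := by
    rintro u w (_ | _) p q (hpq : (p : ℕ) < q) <;> simp [emb, Fin.lt_def, hpq]
  have hlt : ∀ (u w : List Γ) (i j : Bool), i < j → ∀ p q, emb u w i p < emb u w j q := by
    rintro u w (_ | _) (_ | _) hij p q <;> first | exact absurd hij (by decide) | skip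
    have : (p : ℕ) < u.length := p.2
    simp [emb, Fin.lt_def]; omega
  have hsurj : ∀ (u w : List Γ) x, ∃ i p, emb u w i p = x := by
    intro u w x
    by_cases hx : (x : ℕ) < u.length
    · exact ⟨false, ⟨x, hx⟩, rfl⟩
    · have : (x : ℕ) < u.length + w.length := List.length_append ▸ x.2
      exact ⟨true, ⟨x - u.length, by simp [part]; omega⟩, Fin.ext (by simp [emb]; omega)⟩
  refine EFEquiv.sum (emb u w) (emb u' w') (hget u w) (hget u' w') (hmono u w) (hmono u' w')
    (hlt u w) (hlt u' w') (hsurj u w) (hsurj u' w') (by simp) ?_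
  rintro (_ | _)
  · exact hu
  · exact hw

/-- The congruence of finite words that the `k`-round Ehrenfeucht–Fraïssé game does not
distinguish. -/
def efCon (Γ : Type u) (k : ℕ) : Con (FreeMonoid Γ) where
  r u w := EFEquiv u.toList.get w.toList.get k ∅
  iseqv :=
    { refl := fun u => EFEquiv.refl _ k (by simp)
      symm := fun h => h.symm
      trans := fun h₁ h₂ => h₁.trans h₂ (by simp) }
  mul' h₁ h₂ := h₁.append h₂

theorem exists_finite_sentences (Γ : Type u) [Finite Γ] (k : ℕ) :
    ∃ (ι : Type u) (_ : Finite ι) (φ : ι → (wordLanguage Γ).Sentence), ∀ u w : List Γ,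
      (∀ i, FiniteWordSatisfies u (φ i) ↔ FiniteWordSatisfies w (φ i)) →
        efCon Γ k (.ofList u) (.ofList w) := by
  obtain ⟨ι, hι, φ, hφ⟩ := exists_finite_formulas Γ k 0
  refine ⟨ι, hι, φ, fun u w h => ?_⟩
  simp only [finiteWordSatisfies_iff] at h
  exact (hφ u.get w.get _ _ h).mono (Set.empty_subset _)

instance [Finite Γ] (k : ℕ) : Finite (efCon Γ k).Quotient := by
  obtain ⟨ι, _, φ, hφ⟩ := exists_finite_sentences Γ k
  refine Finite.of_surjective
    (fun x : Set.range fun (w : List Γ) i => FiniteWordSatisfies w (φ i) =>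
      ((FreeMonoid.ofList x.2.choose : FreeMonoid Γ) : (efCon Γ k).Quotient)) ?_
  intro q
  induction q using Con.induction_on with | _ w
  refine ⟨⟨_, w.toList, rfl⟩, (Con.eq _).2 (hφ _ w.toList fun i => ?_)⟩
  generalize_proofs h
  exact iff_of_eq (congrFun h.choose_spec i)

theorem isFODefinable_of_efCon [Finite Γ] (k : ℕ) (S : Set (efCon Γ k).Quotient) :
    IsFODefinable ({w | (efCon Γ k).mk' (.ofList w) ∈ S} : Language Γ) := by
  classical
  obtain ⟨ι, _, φ, hφ⟩ := exists_finite_sentences Γ k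
  -- The truth patterns of the words in the language; the defining sentence is the finite
  -- disjunction of their descriptions.
  let T : Set (Set ι) :=
    {s | ∃ w : List Γ, (efCon Γ k).mk' (.ofList w) ∈ S ∧ s = {i | FiniteWordSatisfies w (φ i)}}
  refine ⟨Formula.iSup fun s : T => Formula.iInf fun i => if i ∈ s.1 then φ i else (φ i).not,
    fun w => ?_⟩
  have hsat : ∀ s : Set ι, (∀ i, FiniteWordSatisfies w (if i ∈ s then φ i else (φ i).not)) ↔
      s = {i | FiniteWordSatisfies w (φ i)} := by
    intro s
    rw [Set.ext_iff]
    refine forall_congr' fun i => ?_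
    by_cases hi : i ∈ s
    · simp [hi]
    · simp only [hi, if_false, false_iff, Set.mem_ofPred_eq]
      exact Iff.rfl
  let := wordStructure w.get
  have : FiniteWordSatisfies w
      (Formula.iSup fun s : T => Formula.iInf fun i => if i ∈ s.1 then φ i else (φ i).not) ↔
      ∃ s : T, ∀ i, FiniteWordSatisfies w (if i ∈ s.1 then φ i else (φ i).not) := by
    simp only [FiniteWordSatisfies, Sentence.Realize, Formula.realize_iSup, Formula.realize_iInf]
  rw [this]
  simp only [hsat]
  constructor
  · exact fun hw => ⟨⟨_, w, hw, rfl⟩, rfl⟩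
  · rintro ⟨⟨_, w', hw', rfl⟩, h⟩
    have : (efCon Γ k).mk' (.ofList w') = (efCon Γ k).mk' (.ofList w) :=
      (Con.eq _).2 (hφ w' w fun i => by
        have := Set.ext_iff.1 h i
        exact this)
    exact (this ▸ hw' : (efCon Γ k).mk' (.ofList w) ∈ S)

/-- An infinite word is the ordered sum over `ℕ` of its blocks, so `EFEquiv.sum` combines the
strategies on the blocks. -/
theorem recognizesOmega_efCon {L : Set (Stream' Γ)} {φ : (wordLanguage Γ).Sentence}
    (hL : ∀ x, x ∈ L ↔ OmegaWordSatisfies x φ) :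
    RecognizesOmega (efCon Γ φ.quantifierRank).mk' L := by
  intro x y s t hs ht hs0 ht0 hst hx
  rw [hL, omegaWordSatisfies_iff] at hx ⊢
  refine (EFEquiv.wordRealize_iff φ le_rfl (R := ∅) ?_ (fun i => i.elim0)).1 hx
  let emb : ∀ (x : Stream' Γ) (s : ℕ → ℕ) (i : ℕ), Fin (x.factor (s i) (s (i + 1))).length → ℕ :=
    fun x s i p => s i + p
  have hget : ∀ (x : Stream' Γ) (s : ℕ → ℕ) i p,
      x.get (emb x s i p) = (x.factor (s i) (s (i + 1))).get p := fun x s i p => by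
    simp [emb, Stream'.getElem_factor]
  have hmono : ∀ (x : Stream' Γ) (s : ℕ → ℕ) i, StrictMono (emb x s i) :=
    fun x s i p q hpq => Nat.add_lt_add_left hpq _
  have hlt : ∀ (x : Stream' Γ) (s : ℕ → ℕ), StrictMono s → ∀ i j, i < j → ∀ p q,
      emb x s i p < emb x s j q := fun x s hs i j hij p q => by
    have h₁ := p.2
    have h₂ := hs.monotone (Nat.succ_le_of_lt hij)
    simp [emb] at h₁ h₂ ⊢
    omega
  have hsurj : ∀ (x : Stream' Γ) (s : ℕ → ℕ), StrictMono s → s 0 = 0 → ∀ n, ∃ i p,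
      emb x s i p = n := fun x s hs h0 n => by
    obtain ⟨i, h₁, h₂⟩ := hs.exists_block h0 n
    exact ⟨i, ⟨n - s i, by simp; omega⟩, by simp [emb]; omega⟩
  refine EFEquiv.sum (emb x s) (emb y t) (hget x s) (hget y t) (hmono x s) (hmono y t)
    (hlt x s hs) (hlt y t ht) (hsurj x s hs hs0) (hsurj y t ht ht0) (by simp) fun i => ?_
  exact (Con.eq _).1 (hst i)

end WordCongruence

theorem theorem3 {Γ : Type u} [Finite Γ] (L : Set (Stream' Γ)) (hL : IsOmegaRegular L)
    (α : Stream' Γ) :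
    ∃ (L' : Language Γ) (N : ℕ),
      L'.IsRegular ∧
      (IsOmegaFODefinable L → IsFODefinable L') ∧
      ∀ n : ℕ, N ≤ n → (α.drop n ∈ L ↔ ∃ m : ℕ, (α.drop n).take m ∈ L') := by
  by_cases hFO : IsOmegaFODefinable L
  -- Here `efCon` alone serves both purposes: its quotient is finite, so `L'` is regular as well as
  -- first-order definable.
  · obtain ⟨φ, hφ⟩ := hFO
    obtain ⟨S, N, hS⟩ := (recognizesOmega_efCon hφ).exists_prefix_values α
    exact ⟨_, N, Language.isRegular_of_finite_monoid _ S, fun _ => isFODefinable_of_efCon _ S, hS⟩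
  · obtain ⟨σ, _, M, rfl⟩ := hL
    obtain ⟨S, N, hS⟩ := M.recognizesOmega_runCon.exists_prefix_values α
    exact ⟨_, N, Language.isRegular_of_finite_monoid _ S, fun h => absurd h hFO, hS⟩
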